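/- Let $S$ be a monoid with zero. Let $\mathcal{F}ac\,S$ be the category whose objects are the elements of $S\setminus 0$ and whose morphisms $a\to b$ are the pairs $(\alpha,\beta)\in S\times S$ with $\alpha a\beta=b$, with composition $(\alpha',\beta')(\alpha,\beta)=(\alpha'\alpha,\beta\beta')$. Let $\mathcal{N}at\,S$ be the abelian category of natural systems on $S$, i.e. of functors $\mathbf D:\mathcal{F}ac\,S\to\mathcal{A}b$; write $\mathbf D_a$ for the value at $a$, $\alpha_*=\mathbf D(\alpha,1)$ and $\beta^*=\mathbf D(1,\beta)$. Let $\mathbf Z$ be the trivial natural system: each $\mathbf Z_a$ is infinite cyclic with generator $[a]$, and every morphism $a\to b$ sends $[a]$ to $[b]$. For $n\ge 0$ let $C^n(S,\mathbf D)$ be the group of functions assigning to each $n$-tuple $(a_1,\dots,a_n)$ in $S$ with $a_1\cdots a_n\neq 0$ an element of $\mathbf D_{a_1\cdots a_n}$ (the empty tuple has product $1$, so $C^0(S,\mathbf D)=\mathbf D_1$ if $1\ne 0$), with the coboundary $$(\Delta^n f)(a_1,\dots,a_{n+1})=a_{1*}f(a_2,\dots,a_{n+1})+\sum_{i=1}^n(-1)^i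 f(a_1,\dots,a_ia_{i+1},\dots,a_{n+1})+(-1)^{n+1}a_{n+1}^*f(a_1,\dots,a_n),$$ and let $H^n(S,\mathbf D)$ be the $n$-th cohomology group of this complex. Then: 1. For every $n\ge 0$ there is an isomorphism, natural in $\mathbf D\in\mathcal{N}at\,S$, $$H^n(S,\mathbf D)\cong\mathrm{Ext}^n_{\mathcal{N}at\,S}(\mathbf Z,\mathbf D).$$ 2. For $n\ge 0$ let $\mathbf B_n$ be the natural system whose value at $a$ is the free abelian group on the symbols $[a_0,\dots,a_{n+1}]$ with $a_i\in S$ and $a_0\cdots a_{n+1}=a$, with $\mathbf B_n(\alpha,\beta)[a_0,\dots,a_{n+1}]=[\alpha a_0,a_1,\dots,a_n,a_{n+1}\beta]$, and for $n\ge 1$ let $\partial_n:\mathbf B_n\to\mathbf B_{n-1}$ be given by $\partial_n[a_0,\dots,a_{n+1}]=\sum_{i=0}^n(-1)^i[a_0,\dots,a_ia_{i+1},\dots,a_{n+1}]$. Then the $\mathbf B_n$ are projective objects of $\mathcal{N}at\,S$, and $(\mathbf B_n,\partial_n)_{n\ge0}$, with the augmentation $\mathbf B_0\to\mathbf Z$,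 $[a_0,a_1]\mapsto[a_0a_1]$, is a projective resolution of $\mathbf Z$. 3. Let a (unital) 0-module over $S$ be an abelian group $A$ with an action $(S\setminus0)\times A\to A$ such that $s(a+b)=sa+sb$, $s(ta)=(st)a$ whenever $st\ne0$, and $1a=a$ if $1\neq 0$; morphisms are the equivariant homomorphisms. Let $H_0^n(S,A)$ be the $n$-th cohomology group of the complex of functions $f$ assigning an element of $A$ to each $n$-tuple in $S$ with nonzero product, with the coboundary $x_1f(x_2,\dots,x_{n+1})+\sum_{i=1}^n(-1)^if(x_1,\dots,x_ix_{i+1},\dots,x_{n+1})+(-1)^{n+1}f(x_1,\dots,x_n)$. Let $\mathbf A$ be the natural system with $\mathbf A_s=A$ for all $s$ and $\mathbf A(\alpha,\beta)a=\alpha a$. Then for every $n\ge0$ there is an isomorphism, natural in $A$, $$H_0^n(S,A)\cong\mathrm{Ext}^n_{\mathcal{N}at\,S}(\mathbf Z,\mathbf A).$$ -/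

import Mathlib

open CategoryTheory

universe u

noncomputable section

namespace FacCohomology

/-! ### The category of factorizations and natural systems -/

/-- The objects of the category of factorizations in `S`: the nonzero elements of `S`. -/
structure Fac (S : Type u) [MonoidWithZero S] : Type u where
  val : S
  ne_zero : val ≠ 0

/-- A morphism `a ⟶ b` of factorizations: a pair `(left, right)` with `left * a * right = b`. -/
@[ext]
structure FacHom {S : Type u} [MonoidWithZero S] (a b : Fac S) : Type u where
  left : S
  right : S
  fac : left * a.val * right = b.val

instance (S : Type u) [MonoidWithZero S] : Category.{u} (Fac S) where
  Hom a b := FacHom a b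
  id a := ⟨1, 1, by simp⟩
  comp f g := ⟨g.left * f.left, f.right * g.right, by
    rw [← g.fac, ← f.fac]; simp only [mul_assoc]⟩
  id_comp f := by apply FacHom.ext <;> simp
  comp_id f := by apply FacHom.ext <;> simp
  assoc f g h := by apply FacHom.ext <;> simp [mul_assoc]

/-- The category of natural systems on `S`: functors from the category of factorizations to
abelian groups. -/
abbrev NatSys (S : Type u) [MonoidWithZero S] : Type (u + 1) := Fac S ⥤ AddCommGrpCat.{u}

/-- Functors from a small category to abelian groups form a Grothendieck abelian category.  In
particular there are enough injectives and the groups `Ext` are defined. -/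
instance (S : Type u) [MonoidWithZero S] : IsGrothendieckAbelian.{u} (NatSys S) where
  ab5OfSize := ⟨fun _ _ _ => inferInstance⟩
  hasSeparator :=
    HasSeparator.of_equivalence (C := ((Fac S)ᵒᵖ)ᵒᵖ ⥤ AddCommGrpCat.{u})
      ((opOpEquivalence (Fac S)).congrLeft)

/-- The trivial natural system: every value is infinite cyclic, generated by `ULift.up 1`, and
every morphism sends the generator to the generator. -/
def trivialSystem (S : Type u) [MonoidWithZero S] : NatSys S :=
  (Functor.const (Fac S)).obj (AddCommGrpCat.of (ULift.{u} ℤ))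

/-! ### Tuples and their products -/

section Tuples

variable {S : Type u}

/-- The product `a₁ ⋯ aₙ` of a tuple (`1` for the empty tuple). -/
def tprod [Monoid S] {n : ℕ} (a : Fin n → S) : S := (List.ofFn a).prod

/-- The tuple `(a₁, …, aᵢ aᵢ₊₁, …, aₙ₊₁)`; here the position `i` is counted from `0`. -/
def contract [Monoid S] {n : ℕ} (a : Fin (n + 1) → S) (i : Fin n) : Fin n → S :=
  Fin.contractNth i.castSucc (· * ·) a

theorem tprod_succ [Monoid S] {n : ℕ} (a : Fin (n + 1) → S) :
    tprod a = a 0 * tprod (Fin.tail a) := by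
  simp [tprod, List.ofFn_succ, Fin.tail_def]

theorem tprod_last [Monoid S] {n : ℕ} (a : Fin (n + 1) → S) :
    tprod a = tprod (Fin.init a) * a (Fin.last n) := by
  rw [tprod, List.ofFn_succ']
  simp [tprod, Fin.init_def]

theorem tprod_contract [Monoid S] {n : ℕ} (a : Fin (n + 1) → S) (i : Fin n) :
    tprod (contract a i) = tprod a := by
  induction n with
  | zero => exact i.elim0
  | succ n ih =>
    rw [tprod_succ, tprod_succ a]
    rcases Fin.eq_zero_or_eq_succ i with rfl | ⟨j, rfl⟩
    · have h1 : contract a 0 0 = a 0 * a 1 := by simp [contract, Fin.contractNth]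
      have h2 : Fin.tail (contract a 0) = Fin.tail (Fin.tail a) := by
        ext k
        simp [contract, Fin.contractNth, Fin.tail]
      rw [h1, h2, tprod_succ (Fin.tail a), mul_assoc]
      rfl
    · have h1 : contract a j.succ 0 = a 0 := by simp [contract, Fin.contractNth]
      have h2 : Fin.tail (contract a j.succ) = contract (Fin.tail a) j := by
        ext k
        simp [contract, Fin.contractNth, Fin.tail]
      rw [h1, h2, ih]

theorem contract_contract [Monoid S] {n : ℕ} (a : Fin (n + 2) → S) (i j : Fin n) (h : i ≤ j) :
    contract (contract a j.succ) i = contract (contract a i.castSucc) j := by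
  ext k
  have h' : (i : ℕ) ≤ j := h
  simp only [contract, Fin.contractNth, Fin.val_castSucc, Fin.val_succ]
  split_ifs <;> first | rfl | omega | simp [mul_assoc]

/-- The tuple `(α a₀, a₁, …, aₙ, aₙ₊₁ β)`. -/
def actTuple [Monoid S] {n : ℕ} (α β : S) (a : Fin (n + 2) → S) : Fin (n + 2) → S :=
  fun i => (if i = 0 then α else 1) * a i * (if i = Fin.last (n + 1) then β else 1)

theorem tprod_actTuple [Monoid S] {n : ℕ} (α β : S) (a : Fin (n + 2) → S) :
    tprod (actTuple α β a) = α * tprod a * β := by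
  rw [tprod_succ, tprod_last (Fin.tail (actTuple α β a)), tprod_succ a, tprod_last (Fin.tail a)]
  have h : Fin.init (Fin.tail (actTuple α β a)) = Fin.init (Fin.tail a) := by
    ext k
    have h1 : k.castSucc.succ ≠ Fin.last (n + 1) := by
      intro h; have := congrArg Fin.val h; simp at this; omega
    simp [actTuple, Fin.init, Fin.tail, h1]
  rw [h]
  simp [actTuple, Fin.tail, mul_assoc]

theorem contract_actTuple [Monoid S] {n : ℕ} (α β : S) (a : Fin (n + 3) → S)
    (i : Fin (n + 2)) : contract (actTuple α β a) i = actTuple α β (contract a i) := by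
  ext k
  simp only [contract, Fin.contractNth, actTuple, Fin.val_castSucc, Fin.ext_iff, Fin.val_succ,
    Fin.val_zero, Fin.val_last]
  split_ifs <;> first | contradiction | omega | simp [mul_assoc]

end Tuples

/-- The cancellation behind `d ∘ d = 0` for alternating sums of faces. -/
theorem alternating_sum_eq_zero {M : Type*} [AddCommGroup M] {n : ℕ}
    (g : Fin (n + 2) → Fin (n + 1) → M)
    (hg : ∀ i j : Fin (n + 1), i ≤ j → g j.succ i = g i.castSucc j) :
    ∑ j : Fin (n + 2), (-1 : ℤ) ^ (j : ℕ) • ∑ i : Fin (n + 1), (-1 : ℤ) ^ (i : ℕ) • g j i = 0 := by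
  simp only [Finset.smul_sum, smul_smul, ← pow_add, ← Finset.sum_product']
  rw [Finset.univ_product_univ]
  let s : Finset (Fin (n + 2) × Fin (n + 1)) := {p | (p.2 : ℕ) < (p.1 : ℕ)}
  rw [← Finset.sum_add_sum_compl s, ← eq_neg_iff_add_eq_zero, ← Finset.sum_neg_distrib]
  refine Finset.sum_bij'
    (fun p _ => (p.2.castSucc, ⟨(p.1 : ℕ) - 1, by have := p.1.isLt; omega⟩))
    (fun p hp => (p.2.succ, ⟨(p.1 : ℕ), by
      have h1 : ¬ (p.2 : ℕ) < (p.1 : ℕ) := by simpa [s] using hp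
      have := p.2.isLt; omega⟩)) ?_ ?_ ?_ ?_ ?_
  · rintro ⟨j, i⟩ h
    simp [s] at h ⊢
    omega
  · rintro ⟨j, i⟩ h
    simp [s] at h ⊢
    omega
  · rintro ⟨j, i⟩ h
    simp [s] at h
    ext <;> simp
    omega
  · rintro ⟨j, i⟩ h
    ext <;> simp
  · rintro ⟨j, i⟩ h
    have h' : (i : ℕ) < (j : ℕ) := by simpa [s] using h
    obtain ⟨j, rfl⟩ := Fin.eq_succ_of_ne_zero (i := j) (by rintro rfl; simp at h')
    have h2 : i ≤ j := by simp at h'; exact Fin.le_def.2 (by omega)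
    simp only [Fin.val_succ, Nat.add_sub_cancel, Fin.eta, Fin.val_castSucc, hg i j h2]
    rw [← neg_smul]
    congr 1
    ring

/-! ### Cohomology of `S` with coefficients in a natural system -/

/-- The nerve of `S` in degree `n`: the `n`-tuples with nonzero product. -/
def Nerve (S : Type u) [MonoidWithZero S] (n : ℕ) : Type u :=
  {a : Fin n → S // tprod a ≠ 0}

section Nerve

variable {S : Type u} [MonoidWithZero S] {n : ℕ}

/-- The product of an element of the nerve, as an object of the category of factorizations. -/
def Nerve.obj (a : Nerve S n) : Fac S := ⟨tprod a.1, a.2⟩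

/-- `(a₂, …, aₙ₊₁)`. -/
def Nerve.tail (a : Nerve S (n + 1)) : Nerve S n :=
  ⟨Fin.tail a.1, fun h => a.2 (by rw [tprod_succ, h, mul_zero])⟩

/-- `(a₁, …, aₙ)`. -/
def Nerve.init (a : Nerve S (n + 1)) : Nerve S n :=
  ⟨Fin.init a.1, fun h => a.2 (by rw [tprod_last, h, zero_mul])⟩

/-- `(a₁, …, aᵢ aᵢ₊₁, …, aₙ₊₁)`; here the position `i` is counted from `0`. -/
def Nerve.contract (a : Nerve S (n + 1)) (i : Fin n) : Nerve S n :=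
  ⟨FacCohomology.contract a.1 i, by rw [tprod_contract]; exact a.2⟩

/-- The morphism `(a₁, 1) : a₂ ⋯ aₙ₊₁ ⟶ a₁ ⋯ aₙ₊₁`. -/
def Nerve.tailHom (a : Nerve S (n + 1)) : a.tail.obj ⟶ a.obj :=
  FacHom.mk (a.1 0) 1 (by simp [Nerve.obj, Nerve.tail, tprod_succ a.1])

/-- The morphism `(1, aₙ₊₁) : a₁ ⋯ aₙ ⟶ a₁ ⋯ aₙ₊₁`. -/
def Nerve.initHom (a : Nerve S (n + 1)) : a.init.obj ⟶ a.obj :=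
  FacHom.mk 1 (a.1 (Fin.last n)) (by simp [Nerve.obj, Nerve.init, tprod_last a.1])

/-- The identity of `a₁ ⋯ aₙ₊₁`, its source being written as the product of the contracted
tuple. -/
def Nerve.contractHom (a : Nerve S (n + 1)) (i : Fin n) : (a.contract i).obj ⟶ a.obj :=
  FacHom.mk 1 1 (by simp [Nerve.obj, Nerve.contract, tprod_contract])

end Nerve

/-- The group of `n`-dimensional cochains: functions assigning to `(a₁, …, aₙ)` in the nerve an
element of the value of `D` at `a₁ ⋯ aₙ`. -/
abbrev Cochain {S : Type u} [MonoidWithZero S] (D : NatSys S) (n : ℕ) : Type u :=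
  ∀ a : Nerve S n, D.obj a.obj

/-- The coboundary homomorphism.  The sum over `1 ≤ i ≤ n` is indexed by `i - 1 : Fin n`. -/
def coboundary {S : Type u} [MonoidWithZero S] (D : NatSys S) (n : ℕ) :
    Cochain D n →+ Cochain D (n + 1) where
  toFun f a :=
    D.map a.tailHom (f a.tail) +
      ∑ i : Fin n, (-1 : ℤ) ^ ((i : ℕ) + 1) • D.map (a.contractHom i) (f (a.contract i)) +
      (-1 : ℤ) ^ (n + 1) • D.map a.initHom (f a.init)
  map_zero' := by
    funext a
    simp
  map_add' f g := by
    funext a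
    simp only [Pi.add_apply, map_add, smul_add, Finset.sum_add_distrib]
    abel

section CoboundarySquare

variable {S : Type u} [MonoidWithZero S] {n : ℕ}

/-- All the faces of a tuple, numbered from `0` to `n + 1`. -/
def faceTuple (a : Fin (n + 1) → S) (i : Fin (n + 2)) : Fin n → S := fun k =>
  if (k : ℕ) + 1 < i then a k.castSucc
  else if (k : ℕ) + 1 = i then a k.castSucc * a k.succ else a k.succ

def faceLeft (a : Fin (n + 1) → S) (i : Fin (n + 2)) : S := if (i : ℕ) = 0 then a 0 else 1

def faceRight (a : Fin (n + 1) → S) (i : Fin (n + 2)) : S :=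
  if (i : ℕ) = n + 1 then a (Fin.last n) else 1

theorem faceTuple_zero (a : Fin (n + 1) → S) : faceTuple a 0 = Fin.tail a := by
  ext k; simp [faceTuple, Fin.tail]

theorem faceTuple_last (a : Fin (n + 1) → S) : faceTuple a (Fin.last (n + 1)) = Fin.init a := by
  ext k; simp [faceTuple, Fin.init]

theorem faceTuple_mid (a : Fin (n + 1) → S) (i : Fin n) :
    faceTuple a i.castSucc.succ = contract a i := by
  ext k; simp [faceTuple, contract, Fin.contractNth]

theorem face_fac (a : Fin (n + 1) → S) (i : Fin (n + 2)) :
    faceLeft a i * tprod (faceTuple a i) * faceRight a i = tprod a := by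
  induction i using Fin.cases with
  | zero => rw [faceTuple_zero, tprod_succ a]; simp [faceLeft, faceRight]
  | succ i =>
    induction i using Fin.lastCases with
    | last => rw [Fin.succ_last, faceTuple_last, tprod_last a]; simp [faceLeft, faceRight]
    | cast i =>
      have := i.isLt
      rw [faceTuple_mid, tprod_contract]
      simp [faceLeft, faceRight, this.ne]

theorem face_face (a : Fin (n + 2) → S) (i j : Fin (n + 2)) (h : i ≤ j) :
    faceTuple (faceTuple a j.succ) i = faceTuple (faceTuple a i.castSucc) j := by
  ext k
  have h' : (i : ℕ) ≤ j := h
  simp only [faceTuple, Fin.val_castSucc, Fin.val_succ]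
  split_ifs <;> first | rfl | omega | simp [mul_assoc]

theorem faceLeft_faceLeft (a : Fin (n + 2) → S) (i j : Fin (n + 2)) (h : i ≤ j) :
    faceLeft a j.succ * faceLeft (faceTuple a j.succ) i =
      faceLeft a i.castSucc * faceLeft (faceTuple a i.castSucc) j := by
  have h' : (i : ℕ) ≤ j := h
  rcases Nat.eq_zero_or_pos i with hi | hi
  · rcases Nat.eq_zero_or_pos j with hj | hj
    · simp [faceLeft, faceTuple, hi, hj]
    · simp [faceLeft, faceTuple, hi, hj, hj.ne']
  · simp [faceLeft, hi.ne', (hi.trans_le h').ne']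

theorem faceRight_faceRight (a : Fin (n + 2) → S) (i j : Fin (n + 2)) (h : i ≤ j) :
    faceRight (faceTuple a j.succ) i * faceRight a j.succ =
      faceRight (faceTuple a i.castSucc) j * faceRight a i.castSucc := by
  have h' : (i : ℕ) ≤ j := h
  have hi := i.isLt
  have hj := j.isLt
  simp only [faceRight, faceTuple, Fin.val_castSucc, Fin.val_succ, Fin.val_last]
  split_ifs <;> first | contradiction | omega | simp

def Nerve.face (a : Nerve S (n + 1)) (i : Fin (n + 2)) : Nerve S n :=
  ⟨faceTuple a.1 i, fun h => a.2 (by rw [← face_fac a.1 i, h, mul_zero, zero_mul])⟩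

def Nerve.faceHom (a : Nerve S (n + 1)) (i : Fin (n + 2)) : (a.face i).obj ⟶ a.obj :=
  FacHom.mk (faceLeft a.1 i) (faceRight a.1 i) (face_fac a.1 i)

theorem map_congr (D : NatSys S) (f : Cochain D n) {a b : Nerve S n} {c : Fac S}
    (p : FacHom a.obj c) (q : FacHom b.obj c) (h : a = b) (hl : p.left = q.left)
    (hr : p.right = q.right) :
    D.map (X := a.obj) (Y := c) p (f a) = D.map (X := b.obj) (Y := c) q (f b) := by
  subst h
  rw [FacHom.ext hl hr]

theorem coboundary_apply (D : NatSys S) (f : Cochain D n) (a : Nerve S (n + 1)) :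
    coboundary D n f a =
      ∑ i : Fin (n + 2), (-1 : ℤ) ^ (i : ℕ) • D.map (a.faceHom i) (f (a.face i)) := by
  rw [Fin.sum_univ_succ, Fin.sum_univ_castSucc, ← add_assoc]
  simp only [coboundary, AddMonoidHom.coe_mk, ZeroHom.coe_mk]
  congr 1
  · congr 1
    · simp only [Fin.val_zero, pow_zero, one_smul]
      exact map_congr D f _ _ (Subtype.ext (faceTuple_zero a.1).symm) (by simp [Nerve.tailHom, Nerve.faceHom, faceLeft])
        (by simp [Nerve.tailHom, Nerve.faceHom, faceRight])
    · refine Finset.sum_congr rfl fun i _ => ?_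
      have := i.isLt
      congr 1
      exact map_congr D f _ _ (Subtype.ext (faceTuple_mid a.1 i).symm)
        (by simp [Nerve.contractHom, Nerve.faceHom, faceLeft])
        (by simp [Nerve.contractHom, Nerve.faceHom, faceRight, this.ne])
  · congr 1
    exact map_congr D f _ _ (Subtype.ext (by
      rw [Fin.succ_last]; exact (faceTuple_last a.1).symm))
      (by simp [Nerve.initHom, Nerve.faceHom, faceLeft])
      (by simp [Nerve.initHom, Nerve.faceHom, faceRight])

theorem coboundary_coboundary (D : NatSys S) (f : Cochain D n) :
    coboundary D (n + 1) (coboundary D n f) = 0 := by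
  funext a
  rw [coboundary_apply]
  simp only [coboundary_apply, map_sum, map_zsmul]
  refine alternating_sum_eq_zero
    (fun j i => D.map (a.faceHom j) (D.map ((a.face j).faceHom i) (f ((a.face j).face i)))) ?_
  intro i j h
  rw [← ConcreteCategory.comp_apply, ← ConcreteCategory.comp_apply, ← D.map_comp, ← D.map_comp]
  exact map_congr D f _ _ (Subtype.ext (face_face a.1 i j h)) (faceLeft_faceLeft a.1 i j h)
    (faceRight_faceRight a.1 i j h)

end CoboundarySquare

/-- The cochain complex `C⁰(S, D) ⟶ C¹(S, D) ⟶ ⋯`. -/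
def cochainComplex {S : Type u} [MonoidWithZero S] (D : NatSys S) :
    CochainComplex AddCommGrpCat.{u} ℕ :=
  CochainComplex.of (fun n => AddCommGrpCat.of (Cochain D n))
    (fun n => AddCommGrpCat.ofHom (coboundary D n))
    (fun n => by
      ext f x
      exact congrFun (coboundary_coboundary D f) x)

/-- The effect of a morphism of natural systems on cochains. -/
def cochainMap {S : Type u} [MonoidWithZero S] {D E : NatSys S} (φ : D ⟶ E) (n : ℕ) :
    Cochain D n →+ Cochain E n where
  toFun f a := φ.app a.obj (f a)
  map_zero' := by funext a; simp
  map_add' f g := by funext a; simp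

theorem coboundary_cochainMap {S : Type u} [MonoidWithZero S] {D E : NatSys S} (φ : D ⟶ E) (n : ℕ)
    (f : Cochain D n) :
    coboundary E n (cochainMap φ n f) = cochainMap φ (n + 1) (coboundary D n f) := by
  funext a
  have h {b c : Fac S} (p : b ⟶ c) (x : D.obj b) :
      E.map p (φ.app b x) = φ.app c (D.map p x) := by
    rw [← ConcreteCategory.comp_apply, ← ConcreteCategory.comp_apply, φ.naturality]
  simp only [coboundary, cochainMap, AddMonoidHom.coe_mk, ZeroHom.coe_mk, map_add, map_sum,
    map_zsmul, h]

/-- The cochain complex as a functor of the natural system. -/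
def cochainFunctor (S : Type u) [MonoidWithZero S] :
    NatSys S ⥤ CochainComplex AddCommGrpCat.{u} ℕ where
  obj D := cochainComplex D
  map {D E} φ := CochainComplex.ofHom
    (fun n => AddCommGrpCat.ofHom (cochainMap φ n))
    (fun n => by
      simp only [cochainComplex, CochainComplex.of_d]
      apply AddCommGrpCat.hom_ext
      ext f x
      exact congrFun (coboundary_cochainMap φ n f) x)
  map_id D := by
    ext n f
    rfl
  map_comp φ ψ := by
    ext n f
    rfl

/-- The functor `Hⁿ(S, -)`. -/
def cohomology (S : Type u) [MonoidWithZero S] (n : ℕ) : NatSys S ⥤ AddCommGrpCat.{u} :=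
  cochainFunctor S ⋙ HomologicalComplex.homologyFunctor _ _ n

/-! ### The bar resolution -/

/-- The symbols `[a₀, …, aₙ₊₁]` with `a₀ ⋯ aₙ₊₁ = a`. -/
def Symbol {S : Type u} [MonoidWithZero S] (n : ℕ) (a : Fac S) : Type u :=
  {t : Fin (n + 2) → S // tprod t = a.val}

/-- `[a₀, …, aₙ₊₁] ↦ [α a₀, a₁, …, aₙ, aₙ₊₁ β]`. -/
def Symbol.map {S : Type u} [MonoidWithZero S] {n : ℕ} {a b : Fac S} (f : a ⟶ b)
    (t : Symbol n a) : Symbol n b :=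
  ⟨actTuple f.left f.right t.1, by rw [tprod_actTuple, t.2]; exact f.fac⟩

/-- `[a₀, …, aₙ₊₂] ↦ [a₀, …, aᵢ aᵢ₊₁, …, aₙ₊₂]`. -/
def Symbol.face {S : Type u} [MonoidWithZero S] {n : ℕ} {a : Fac S} (t : Symbol (n + 1) a)
    (i : Fin (n + 2)) : Symbol n a :=
  ⟨contract t.1 i, by rw [tprod_contract, t.2]⟩

/-- The natural system `Bₙ`, whose value at `a` is free abelian on the symbols
`[a₀, …, aₙ₊₁]` with `a₀ ⋯ aₙ₊₁ = a`. -/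
def bar (S : Type u) [MonoidWithZero S] (n : ℕ) : NatSys S where
  obj a := AddCommGrpCat.of (FreeAbelianGroup (Symbol n a))
  map f := AddCommGrpCat.ofHom (FreeAbelianGroup.map (Symbol.map f))
  map_id a := by
    have h : Symbol.map (𝟙 a) = (id : Symbol n a → Symbol n a) := by
      funext t
      refine Subtype.ext (funext fun i => ?_)
      change (if i = 0 then (1 : S) else 1) * t.1 i * (if i = Fin.last (n + 1) then 1 else 1) = t.1 i
      simp
    rw [h, FreeAbelianGroup.map_id]
    rfl
  map_comp {a b c} f g := by
    have h : Symbol.map (f ≫ g) =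
        (Symbol.map g : Symbol n b → Symbol n c) ∘ (Symbol.map f : Symbol n a → Symbol n b) := by
      funext t
      refine Subtype.ext (funext fun i => ?_)
      change (if i = 0 then g.left * f.left else 1) * t.1 i *
        (if i = Fin.last (n + 1) then f.right * g.right else 1) =
        (if i = 0 then g.left else 1) * ((if i = 0 then f.left else 1) * t.1 i *
        (if i = Fin.last (n + 1) then f.right else 1)) *
        (if i = Fin.last (n + 1) then g.right else 1)
      split_ifs <;> simp [mul_assoc]
    rw [h, FreeAbelianGroup.map_comp]
    rfl

/-- `[a₀, …, aₙ₊₂] ↦ ∑ i, (-1) ^ i [a₀, …, aᵢ aᵢ₊₁, …, aₙ₊₂]`, where `0 ≤ i ≤ n + 1`. -/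
def barBoundaryAt {S : Type u} [MonoidWithZero S] (n : ℕ) (a : Fac S) :
    FreeAbelianGroup (Symbol (n + 1) a) →+ FreeAbelianGroup (Symbol n a) :=
  FreeAbelianGroup.lift fun t =>
    ∑ i : Fin (n + 2), (-1 : ℤ) ^ (i : ℕ) • FreeAbelianGroup.of (t.face i)

/-- The boundary `Bₙ₊₁ ⟶ Bₙ`. -/
def barBoundary (S : Type u) [MonoidWithZero S] (n : ℕ) : bar S (n + 1) ⟶ bar S n where
  app a := AddCommGrpCat.ofHom (barBoundaryAt n a)
  naturality a b f := by
    apply AddCommGrpCat.hom_ext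
    apply FreeAbelianGroup.lift_ext
    intro t
    change barBoundaryAt n b (FreeAbelianGroup.map (Symbol.map f) (FreeAbelianGroup.of t)) =
      FreeAbelianGroup.map (Symbol.map f) (barBoundaryAt n a (FreeAbelianGroup.of t))
    have h (i : Fin (n + 2)) : (Symbol.map f t).face i = Symbol.map f (t.face i) :=
      Subtype.ext (contract_actTuple _ _ _ _)
    simp [barBoundaryAt, FreeAbelianGroup.map_of_apply, map_sum, map_zsmul, h]

/-- The bar complex `⋯ ⟶ B₁ ⟶ B₀`. -/
def barComplex (S : Type u) [MonoidWithZero S] : ChainComplex (NatSys S) ℕ :=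
  ChainComplex.of (bar S) (barBoundary S) (fun n => by
    ext a : 2
    apply AddCommGrpCat.hom_ext
    apply FreeAbelianGroup.lift_ext
    intro t
    change barBoundaryAt n a (barBoundaryAt (n + 1) a (FreeAbelianGroup.of t)) = 0
    simp only [barBoundaryAt, FreeAbelianGroup.lift_apply_of, map_sum, map_zsmul]
    exact alternating_sum_eq_zero (fun j i => FreeAbelianGroup.of ((t.face j).face i))
      (fun i j h => congrArg _ (Subtype.ext (contract_contract t.1 i j h))))

/-- `B₀ ⟶ ℤ`, sending each symbol `[a₀, a₁]` to the generator. -/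
def barAugmentation₀ (S : Type u) [MonoidWithZero S] : bar S 0 ⟶ trivialSystem S where
  app a := AddCommGrpCat.ofHom (FreeAbelianGroup.lift fun _ => ULift.up 1)
  naturality a b f := by
    apply AddCommGrpCat.hom_ext
    apply FreeAbelianGroup.lift_ext
    intro t
    change FreeAbelianGroup.lift (fun _ => (ULift.up 1 : ULift.{u} ℤ))
      (FreeAbelianGroup.map (Symbol.map f) (FreeAbelianGroup.of t)) =
      FreeAbelianGroup.lift (fun _ => (ULift.up 1 : ULift.{u} ℤ)) (FreeAbelianGroup.of t)
    simp [FreeAbelianGroup.map_of_apply]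

/-- The augmentation of the bar complex, as a chain map to `ℤ` placed in degree `0`. -/
def barAugmentation (S : Type u) [MonoidWithZero S] :
    barComplex S ⟶ (ChainComplex.single₀ (NatSys S)).obj (trivialSystem S) :=
  (ChainComplex.toSingle₀Equiv _ _).symm ⟨barAugmentation₀ S, by
    have h : (barComplex S).d 1 0 = barBoundary S 0 := ChainComplex.of_d (bar S) (barBoundary S) 0
    rw [h]
    ext a : 2
    apply AddCommGrpCat.hom_ext
    apply FreeAbelianGroup.lift_ext
    intro t
    change FreeAbelianGroup.lift (fun _ => (ULift.up 1 : ULift.{u} ℤ))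
      (barBoundaryAt 0 a (FreeAbelianGroup.of t)) = 0
    simp [barBoundaryAt, Fin.sum_univ_two]⟩

/-! ### 0-modules and 0-cohomology -/

/-- A (unital) 0-module over the monoid `S` with zero: an abelian group on which the nonzero
elements of `S` act by endomorphisms, with `s (t a) = (s t) a` whenever `s t ≠ 0`, and with `1`
acting as the identity. -/
structure ZeroModule (S : Type u) [MonoidWithZero S] : Type (u + 1) where
  carrier : Type u
  [grp : AddCommGroup carrier]
  act : ∀ s : S, s ≠ 0 → (carrier →+ carrier)
  act_act : ∀ (s t : S) (hs : s ≠ 0) (ht : t ≠ 0) (hst : s * t ≠ 0) (a : carrier),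
    act s hs (act t ht a) = act (s * t) hst a
  act_one : ∀ (h : (1 : S) ≠ 0) (a : carrier), act 1 h a = a

attribute [instance] ZeroModule.grp

/-- Morphisms of 0-modules: equivariant additive maps. -/
@[ext]
structure ZeroModuleHom {S : Type u} [MonoidWithZero S] (A B : ZeroModule S) : Type u where
  toHom : A.carrier →+ B.carrier
  map_act : ∀ (s : S) (hs : s ≠ 0) (a : A.carrier), toHom (A.act s hs a) = B.act s hs (toHom a)

instance (S : Type u) [MonoidWithZero S] : Category.{u} (ZeroModule S) where
  Hom A B := ZeroModuleHom A B
  id A := ⟨AddMonoidHom.id _, fun _ _ _ => rfl⟩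
  comp f g := ⟨g.toHom.comp f.toHom, fun s hs a => by simp [f.map_act, g.map_act]⟩

section ZeroCohomology

variable {S : Type u} [MonoidWithZero S]

theorem FacHom.left_ne_zero {a b : Fac S} (f : FacHom a b) : f.left ≠ 0 := fun h =>
  b.ne_zero (by rw [← f.fac, h, zero_mul, zero_mul])

/-- A 0-module `A` viewed as a natural system: constant value `A`, the morphism `(α, β)` acting
as `a ↦ α a`. -/
def ZeroModule.toNatSys (A : ZeroModule S) : NatSys S where
  obj _ := AddCommGrpCat.of A.carrier
  map {a b} f := AddCommGrpCat.ofHom (A.act f.left (FacHom.left_ne_zero f))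
  map_id a := by
    ext x
    exact A.act_one _ x
  map_comp {a b c} f g := by
    ext x
    exact (A.act_act _ _ _ _ _ x).symm

/-- The functor from 0-modules to natural systems. -/
def zeroModuleToNatSys (S : Type u) [MonoidWithZero S] : ZeroModule S ⥤ NatSys S where
  obj A := A.toNatSys
  map {A B} φ :=
    { app := fun _ => AddCommGrpCat.ofHom φ.toHom
      naturality := fun a b f => by
        ext x
        exact φ.map_act _ _ x }

/-- The group of `n`-dimensional 0-cochains: partial `n`-place maps to `A`, defined on the tuples
with nonzero product. -/
abbrev ZeroCochain (A : ZeroModule S) (n : ℕ) : Type u := Nerve S n → A.carrier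

theorem Nerve.head_ne_zero {n : ℕ} (a : Nerve S (n + 1)) : a.1 0 ≠ 0 := fun h =>
  a.2 (by rw [tprod_succ, h, zero_mul])

/-- The coboundary of 0-cochains.  The sum over `1 ≤ i ≤ n` is indexed by `i - 1 : Fin n`. -/
def zeroCoboundary (A : ZeroModule S) (n : ℕ) : ZeroCochain A n →+ ZeroCochain A (n + 1) where
  toFun f a :=
    A.act (a.1 0) a.head_ne_zero (f a.tail) +
      ∑ i : Fin n, (-1 : ℤ) ^ ((i : ℕ) + 1) • f (a.contract i) +
      (-1 : ℤ) ^ (n + 1) • f a.init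
  map_zero' := by
    funext a
    simp
  map_add' f g := by
    funext a
    simp only [Pi.add_apply, map_add, smul_add, Finset.sum_add_distrib]
    abel

theorem zeroCoboundary_eq (A : ZeroModule S) (n : ℕ) (f : ZeroCochain A n) :
    zeroCoboundary A n f = coboundary A.toNatSys n f := by
  funext a
  have h (b c : Fac S) (p : b ⟶ c) (hp : FacHom.left p = 1) (x : A.carrier) :
      A.toNatSys.map p x = x := by
    change A.act (FacHom.left p) _ x = x
    have key : ∀ (s : S) (hs : s ≠ 0), s = 1 → A.act s hs x = x := by
      rintro s hs rfl
      exact A.act_one hs x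
    exact key _ _ hp
  have h1 (i : Fin n) := h _ _ (a.contractHom i) rfl (f (a.contract i))
  have h2 := h _ _ a.initHom rfl (f a.init)
  change _ = A.toNatSys.map a.tailHom (f a.tail) +
      ∑ i : Fin n, (-1 : ℤ) ^ ((i : ℕ) + 1) • A.toNatSys.map (a.contractHom i) (f (a.contract i)) +
      (-1 : ℤ) ^ (n + 1) • A.toNatSys.map a.initHom (f a.init)
  simp only [h1, h2]
  rfl

theorem zeroCoboundary_zeroCoboundary (A : ZeroModule S) (n : ℕ) (f : ZeroCochain A n) :
    zeroCoboundary A (n + 1) (zeroCoboundary A n f) = 0 := by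
  rw [zeroCoboundary_eq A (n + 1), zeroCoboundary_eq A n]
  exact coboundary_coboundary A.toNatSys f

/-- The complex of 0-cochains. -/
def zeroCochainComplex (A : ZeroModule S) : CochainComplex AddCommGrpCat.{u} ℕ :=
  CochainComplex.of (fun n => AddCommGrpCat.of (ZeroCochain A n))
    (fun n => AddCommGrpCat.ofHom (zeroCoboundary A n))
    (fun n => by
      ext f x
      exact congrFun (zeroCoboundary_zeroCoboundary A n f) x)

/-- The complex of 0-cochains as a functor of the 0-module. -/
def zeroCochainFunctor (S : Type u) [MonoidWithZero S] :
    ZeroModule S ⥤ CochainComplex AddCommGrpCat.{u} ℕ where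
  obj A := zeroCochainComplex A
  map {A B} φ := CochainComplex.ofHom
    (fun n => AddCommGrpCat.ofHom (φ.toHom.compLeft (Nerve S n)))
    (fun n => by
      simp only [zeroCochainComplex, CochainComplex.of_d]
      apply AddCommGrpCat.hom_ext
      ext f x
      change zeroCoboundary B n (φ.toHom ∘ f) x = φ.toHom (zeroCoboundary A n f x)
      simp [zeroCoboundary, φ.map_act])
  map_id A := by
    ext n f
    rfl
  map_comp φ ψ := by
    ext n f
    rfl

/-- The functor `H₀ⁿ(S, -)` on 0-modules. -/
def zeroCohomology (S : Type u) [MonoidWithZero S] (n : ℕ) :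
    ZeroModule S ⥤ AddCommGrpCat.{u} :=
  zeroCochainFunctor S ⋙ HomologicalComplex.homologyFunctor _ _ n

end ZeroCohomology

end FacCohomology

end

/-! The natural system `bar S n` is free. A morphism `(α, β)` only changes the two outer entries of
a symbol, so `[a₀, …, aₙ₊₁]` is the image of `[1, a₁, …, aₙ, 1]` under the morphism `(a₀, aₙ₊₁)` and
under no other. Hence `Bₙ` is the direct sum, over the nerve, of the free abelian groups on `Hom(a₁
⋯ aₙ, -)`. By Yoneda, morphisms `Bₙ ⟶ D` are the same as `n`-cochains (`cochainOfHom`,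
`homOfCochain`). Contracting `[1, a₁, …, aₙ₊₁, 1]` at an end pushes `a₁` or `aₙ₊₁` into the outer
entry, which is the action of `a₁⁎` or `aₙ₊₁^*`. Precomposition with `∂` therefore becomes the
coboundary (`cochainOfHom_barBoundary_comp`).

Projectivity follows from freeness, since epimorphisms of natural systems are objectwise surjective.
For the resolution, `[a₀, …, aₙ₊₁] ↦ [1, a₀, …, aₙ₊₁]` contracts the augmented complex at each
object. This map does not commute with the left action, but exactness of functors is tested
objectwise.

`Extⁿ(ℤ, D)` is then represented by morphisms on `Bₙ` that vanish on boundaries, modulo those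
factoring through `∂`, that is, by cocycles modulo coboundaries. Degree 0 needs separate care, as
nothing is divided out there. A 0-module has the same cochain complex as its natural system, so its
case follows by restriction. -/

noncomputable section

namespace FacCohomology

/-! ### Symbols as free orbits of the symbols `[1, a₁, …, aₙ, 1]` -/

section Symbols

variable {S : Type u} [MonoidWithZero S] {n : ℕ}

theorem tprod_eq_mul_mul (t : Fin (n + 2) → S) :
    tprod t = t 0 * tprod (Fin.init (Fin.tail t)) * t (Fin.last (n + 1)) := by
  rw [tprod_succ, tprod_last (Fin.tail t), mul_assoc]
  rfl

/-- The inner part `(a₁, …, aₙ)` of the symbol `[a₀, …, aₙ₊₁]`. -/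
def Symbol.inner {a : Fac S} (t : Symbol n a) : Nerve S n :=
  ⟨Fin.init (Fin.tail t.1), fun h => a.ne_zero (by
    rw [← t.2, tprod_eq_mul_mul, h, mul_zero, zero_mul])⟩

/-- The morphism `(a₀, aₙ₊₁) : a₁ ⋯ aₙ ⟶ a₀ ⋯ aₙ₊₁`. -/
def Symbol.innerHom {a : Fac S} (t : Symbol n a) : t.inner.obj ⟶ a :=
  FacHom.mk (t.1 0) (t.1 (Fin.last (n + 1))) ((tprod_eq_mul_mul t.1).symm.trans t.2)

/-- The tuple `(1, a₁, …, aₙ, 1)`. -/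
def padTuple (x : Fin n → S) : Fin (n + 2) → S := fun k =>
  if h : (k : ℕ) = 0 ∨ (k : ℕ) = n + 1 then 1 else x ⟨(k : ℕ) - 1, by omega⟩

theorem init_tail_padTuple (x : Fin n → S) : Fin.init (Fin.tail (padTuple x)) = x := by
  ext k
  have := k.isLt
  simp [padTuple, Fin.init, Fin.tail, this.ne]

theorem tprod_padTuple (x : Fin n → S) : tprod (padTuple x) = tprod x := by
  rw [tprod_eq_mul_mul, init_tail_padTuple]
  simp [padTuple]

/-- The symbol `[1, a₁, …, aₙ, 1]`. -/
def Nerve.symbol (x : Nerve S n) : Symbol n x.obj := ⟨padTuple x.1, tprod_padTuple x.1⟩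

theorem inner_symbol (x : Nerve S n) : x.symbol.inner = x :=
  Subtype.ext (init_tail_padTuple x.1)

/-- The symbols `[1, a₁, …, aₙ, 1]` generate: a morphism out of `Bₙ` is determined by its values on
them. -/
theorem map_innerHom_symbol {a : Fac S} (t : Symbol n a) :
    Symbol.map t.innerHom t.inner.symbol = t := by
  refine Subtype.ext (funext fun k => ?_)
  change (if k = 0 then t.1 0 else 1) * padTuple (Fin.init (Fin.tail t.1)) k *
    (if k = Fin.last (n + 1) then t.1 (Fin.last (n + 1)) else 1) = t.1 k
  induction k using Fin.cases with
  | zero => simp [padTuple, Fin.ext_iff]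
  | succ k =>
    induction k using Fin.lastCases with
    | last => simp [padTuple, Fin.ext_iff]
    | cast k =>
      have := k.isLt
      simp [padTuple, Fin.ext_iff, Fin.init, Fin.tail, this.ne]

/-- The action touches only the outer entries, so the inner part labels the orbit of a symbol. -/
theorem inner_map {a b : Fac S} (f : a ⟶ b) (t : Symbol n a) :
    (Symbol.map f t).inner = t.inner := by
  refine Subtype.ext (funext fun k => ?_)
  have := k.isLt
  change actTuple f.left f.right t.1 k.castSucc.succ = t.1 k.castSucc.succ
  simp [actTuple, Fin.ext_iff, this.ne]

/-- The sources of the two morphisms agree only through `inner_map`, so they are compared component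
by component, which is the form that `map_congr` takes. -/
theorem innerHom_map_left {a b : Fac S} (f : a ⟶ b) (t : Symbol n a) :
    (Symbol.map f t).innerHom.left = (t.innerHom ≫ f).left := by
  change actTuple f.left f.right t.1 0 = f.left * t.1 0
  simp [actTuple, Fin.ext_iff]

theorem innerHom_map_right {a b : Fac S} (f : a ⟶ b) (t : Symbol n a) :
    (Symbol.map f t).innerHom.right = (t.innerHom ≫ f).right := by
  change actTuple f.left f.right t.1 (Fin.last (n + 1)) = t.1 (Fin.last (n + 1)) * f.right
  simp [actTuple, Fin.ext_iff]

/-- At an interior position the contraction leaves both outer 1s alone. At an end it absorbs the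
neighbouring entry into a 1, and that entry reappears as `faceLeft` or `faceRight`. This is the
source of the two outer terms of the coboundary. -/
theorem contract_padTuple (x : Fin (n + 1) → S) (i : Fin (n + 2)) :
    contract (padTuple x) i =
      actTuple (faceLeft x i) (faceRight x i) (padTuple (faceTuple x i)) := by
  -- `X` extends the padded tuple to all of `ℕ`, with `x` shifted by one place. Every entry below
  -- becomes a value of `X` at a natural number, free of bounds proofs.
  obtain ⟨X, hX, hX0, hX1⟩ : ∃ X : ℕ → S, (∀ (m : ℕ) (h : m < n + 1), x ⟨m, h⟩ = X (m + 1)) ∧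
      X 0 = 1 ∧ X (n + 2) = 1 :=
    ⟨fun m => if h : m = 0 ∨ n + 1 < m then 1 else x ⟨m - 1, by omega⟩,
      fun m h => by simp [show ¬ n < m by omega], by simp, by simp⟩
  have hpad (m : ℕ) (h : m < n + 3) : padTuple x ⟨m, h⟩ = X m := by
    simp only [padTuple]
    split_ifs with h'
    · rcases h' with rfl | rfl
      · exact hX0.symm
      · exact hX1.symm
    · rw [hX]
      congr 1
      omega
  have hface (m : ℕ) (h : m < n) : faceTuple x i ⟨m, h⟩ =
      if m + 1 < i then X (m + 1) else
        if m + 1 = i then X (m + 1) * X (m + 2) else X (m + 2) := by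
    rw [← hX m (by omega), ← hX (m + 1) (by omega)]
    rfl
  have hl : faceLeft x i = if (i : ℕ) = 0 then X 1 else 1 := by
    rw [← hX 0 (by omega)]
    rfl
  have hr : faceRight x i = if (i : ℕ) = n + 1 then X (n + 1) else 1 := by
    rw [← hX n (by omega)]
    rfl
  ext ⟨k, hk⟩
  have hi := i.isLt
  have hc : contract (padTuple x) i ⟨k, hk⟩ =
      if k < i then X k else if k = i then X k * X (k + 1) else X (k + 1) := by
    rw [← hpad k (by omega), ← hpad (k + 1) (by omega)]
    rfl
  rw [hc, actTuple, hl, hr]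
  simp only [Fin.ext_iff, Fin.val_zero, Fin.val_last]
  -- Three ranges of positions: the left outer entry, the inner entries, and the right outer entry
  -- `k = n + 1`.
  rcases Nat.eq_zero_or_pos k with rfl | hk0
  · have hp : padTuple (faceTuple x i) ⟨0, hk⟩ = 1 := by simp [padTuple]
    rw [hp, hX0]
    split_ifs <;> first | contradiction | omega | simp
  · obtain ⟨m, rfl⟩ := Nat.exists_eq_succ_of_ne_zero hk0.ne'
    rcases Nat.lt_or_ge m n with hm | hm
    · have hp : padTuple (faceTuple x i) ⟨m + 1, hk⟩ = faceTuple x i ⟨m, hm⟩ := by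
        simp [padTuple, hm.ne]
      rw [hp, hface]
      split_ifs <;> first | contradiction | omega | simp
    · obtain rfl : m = n := by omega
      have hp : padTuple (faceTuple x i) ⟨m + 1, hk⟩ = 1 := by simp [padTuple]
      rw [hp, hX1]
      split_ifs <;> first | contradiction | omega | simp

theorem face_symbol (x : Nerve S (n + 1)) (i : Fin (n + 2)) :
    x.symbol.face i = Symbol.map (x.faceHom i) (x.face i).symbol :=
  Subtype.ext (contract_padTuple x.1 i)

end Symbols

/-! ### Yoneda for the bar systems, and projectivity -/

section HomBar

variable {S : Type u} [MonoidWithZero S] {n : ℕ} {D E : NatSys S}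

/-- The cochain `(a₁, …, aₙ) ↦ φ [1, a₁, …, aₙ, 1]`. -/
def cochainOfHom (φ : bar S n ⟶ D) : Cochain D n := fun x =>
  φ.app x.obj (FreeAbelianGroup.of x.symbol)

/-- The morphism `[a₀, …, aₙ₊₁] ↦ a₀⁎ aₙ₊₁^* f (a₁, …, aₙ)`. -/
def homOfCochain (f : Cochain D n) : bar S n ⟶ D where
  app a := AddCommGrpCat.ofHom (FreeAbelianGroup.lift fun t => D.map t.innerHom (f t.inner))
  naturality a b g := by
    apply AddCommGrpCat.hom_ext
    apply FreeAbelianGroup.lift_ext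
    intro t
    change FreeAbelianGroup.lift (fun t => D.map t.innerHom (f t.inner))
      (FreeAbelianGroup.map (Symbol.map g) (FreeAbelianGroup.of t)) =
      D.map g (FreeAbelianGroup.lift (fun t => D.map t.innerHom (f t.inner))
        (FreeAbelianGroup.of t))
    rw [FreeAbelianGroup.map_of_apply, FreeAbelianGroup.lift_apply_of,
      FreeAbelianGroup.lift_apply_of, ← ConcreteCategory.comp_apply, ← D.map_comp]
    exact map_congr D f _ _ (inner_map g t) (innerHom_map_left g t) (innerHom_map_right g t)

theorem homOfCochain_app_of (f : Cochain D n) {a : Fac S} (t : Symbol n a) :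
    (homOfCochain f).app a (FreeAbelianGroup.of t) = D.map t.innerHom (f t.inner) :=
  FreeAbelianGroup.lift_apply_of _ _

theorem hom_app_map (φ : bar S n ⟶ D) {a b : Fac S} (g : a ⟶ b) (t : Symbol n a) :
    φ.app b (FreeAbelianGroup.of (Symbol.map g t)) =
      D.map g (φ.app a (FreeAbelianGroup.of t)) := by
  refine (congrArg (φ.app b) (FreeAbelianGroup.map_of_apply t).symm).trans ?_
  exact congrArg (fun ψ => ψ (FreeAbelianGroup.of t)) (φ.naturality g)

@[simp]
theorem cochainOfHom_homOfCochain (f : Cochain D n) : cochainOfHom (homOfCochain f) = f := by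
  funext x
  refine (homOfCochain_app_of f x.symbol).trans ?_
  -- The morphism attached to `[1, a₁, …, aₙ, 1]` is `(1, 1)`, an identity once its source is
  -- identified by `inner_symbol`.
  refine (map_congr D f x.symbol.innerHom (𝟙 x.obj) (inner_symbol x) ?_ ?_).trans ?_
  · exact (by simp [padTuple] : padTuple x.1 0 = 1)
  · exact (by simp [padTuple] : padTuple x.1 (Fin.last (n + 1)) = 1)
  · exact congrArg (fun g => g (f x)) (D.map_id x.obj)

@[simp]
theorem homOfCochain_cochainOfHom (φ : bar S n ⟶ D) : homOfCochain (cochainOfHom φ) = φ := by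
  ext a : 2
  apply AddCommGrpCat.hom_ext
  apply FreeAbelianGroup.lift_ext
  intro t
  refine (homOfCochain_app_of _ t).trans ?_
  refine (hom_app_map φ t.innerHom t.inner.symbol).symm.trans ?_
  rw [map_innerHom_symbol]
  rfl

/-- Reduces identities between morphisms out of `Bₙ` to identities between cochains. -/
theorem cochainOfHom_injective : Function.Injective (cochainOfHom (D := D) (n := n)) :=
  Function.LeftInverse.injective homOfCochain_cochainOfHom

theorem cochainOfHom_add (φ ψ : bar S n ⟶ D) :
    cochainOfHom (φ + ψ) = cochainOfHom φ + cochainOfHom ψ := rfl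

theorem homOfCochain_add (f g : Cochain D n) :
    homOfCochain (f + g) = homOfCochain f + homOfCochain g :=
  cochainOfHom_injective (by simp [cochainOfHom_add])

@[simp]
theorem homOfCochain_zero : homOfCochain (0 : Cochain D n) = 0 :=
  cochainOfHom_injective (by rw [cochainOfHom_homOfCochain]; rfl)

theorem cochainOfHom_comp (φ : bar S n ⟶ D) (ψ : D ⟶ E) :
    cochainOfHom (φ ≫ ψ) = cochainMap ψ n (cochainOfHom φ) := rfl

theorem homOfCochain_comp (f : Cochain D n) (ψ : D ⟶ E) :
    homOfCochain f ≫ ψ = homOfCochain (cochainMap ψ n f) :=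
  cochainOfHom_injective (by simp [cochainOfHom_comp])

/-- By `face_symbol` each face of `[1, a₁, …, aₙ₊₁, 1]` is a translate of a symbol of the same
shape, and naturality of `φ` turns the translation into the action on `D`. -/
theorem cochainOfHom_barBoundary_comp (φ : bar S n ⟶ D) :
    cochainOfHom (barBoundary S n ≫ φ) = coboundary D n (cochainOfHom φ) := by
  funext x
  rw [coboundary_apply]
  have h : (barBoundary S n).app x.obj (FreeAbelianGroup.of x.symbol) =
      ∑ i : Fin (n + 2), (-1 : ℤ) ^ (i : ℕ) • FreeAbelianGroup.of (x.symbol.face i) :=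
    FreeAbelianGroup.lift_apply_of _ _
  refine (congrArg (φ.app x.obj) h).trans ?_
  refine (map_sum (φ.app x.obj).hom _ _).trans (Finset.sum_congr rfl fun i _ => ?_)
  refine (map_zsmul (φ.app x.obj).hom _ _).trans (congrArg _ ?_)
  rw [face_symbol]
  exact hom_app_map φ _ _

theorem barBoundary_comp_homOfCochain (f : Cochain D n) :
    barBoundary S n ≫ homOfCochain f = homOfCochain (coboundary D n f) :=
  cochainOfHom_injective (by simp [cochainOfHom_barBoundary_comp])

instance bar_projective (S : Type u) [MonoidWithZero S] (n : ℕ) : Projective (bar S n) where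
  factors {E X} φ e _ := by
    have he (a : Fac S) : Function.Surjective (e.app a) :=
      (AddCommGrpCat.epi_iff_surjective _).1 inferInstance
    -- By freeness, arbitrary lifts of the values on generators define a morphism; no compatibility
    -- has to be checked.
    choose g hg using fun x : Nerve S n => he x.obj (cochainOfHom φ x)
    refine ⟨homOfCochain g, cochainOfHom_injective ?_⟩
    rw [cochainOfHom_comp, cochainOfHom_homOfCochain]
    exact funext hg

end HomBar

/-! ### Objectwise exactness and the contracting homotopy -/

/-- A short complex in a category of functors is exact if all its evaluations are. -/
theorem exact_of_exact_evaluation {J : Type*} [Category* J] {V : Type*} [Category* V] [Abelian V]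
    (T : ShortComplex (J ⥤ V)) (h : ∀ j, (T.map ((evaluation J V).obj j)).Exact) : T.Exact := by
  rw [ShortComplex.exact_iff_isZero_homology]
  refine Functor.isZero _ fun j => ?_
  -- Evaluation at an object preserves homology.
  exact Limits.IsZero.of_iso ((ShortComplex.exact_iff_isZero_homology _).1 (h j))
    (T.mapHomologyIso ((evaluation J V).obj j)).symm

section Homotopy

variable {S : Type u} [MonoidWithZero S] {n : ℕ} {a : Fac S}

/-- `[a₀, …, aₙ₊₁] ↦ [1, a₀, …, aₙ₊₁]`. -/
def Symbol.consOne (t : Symbol n a) : Symbol (n + 1) a :=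
  ⟨Fin.cons (α := fun _ => S) 1 t.1, by rw [tprod_succ, Fin.tail_cons, Fin.cons_zero, one_mul, t.2]⟩

theorem face_zero_consOne (t : Symbol n a) : t.consOne.face 0 = t := by
  refine Subtype.ext (funext fun k => ?_)
  change contract (Fin.cons (α := fun _ => S) 1 t.1) 0 k = t.1 k
  induction k using Fin.cases <;> simp [contract, Fin.contractNth]

theorem face_succ_consOne (t : Symbol (n + 1) a) (i : Fin (n + 2)) :
    t.consOne.face i.succ = (t.face i).consOne := by
  refine Subtype.ext (funext fun k => ?_)
  change contract (Fin.cons (α := fun _ => S) 1 t.1) i.succ k =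
    (Fin.cons (α := fun _ => S) 1 (contract t.1 i) : Fin (n + 3) → S) k
  induction k using Fin.cases <;> simp [contract, Fin.contractNth]

/-- The contracting homotopy of the bar complex at the object `a`. -/
def barHomotopyAt (n : ℕ) (a : Fac S) :
    FreeAbelianGroup (Symbol n a) →+ FreeAbelianGroup (Symbol (n + 1) a) :=
  FreeAbelianGroup.map Symbol.consOne

/-- Face 0 removes the inserted 1 and returns the symbol. Face `i + 1` is the homotopy applied to
face `i`, with the opposite sign, so these terms cancel. -/
theorem barBoundaryAt_barHomotopyAt_succ (x : FreeAbelianGroup (Symbol (n + 1) a)) :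
    barBoundaryAt (n + 1) a (barHomotopyAt (n + 1) a x) +
      barHomotopyAt n a (barBoundaryAt n a x) = x := by
  suffices h : (barBoundaryAt (n + 1) a).comp (barHomotopyAt (n + 1) a) +
      (barHomotopyAt n a).comp (barBoundaryAt n a) = AddMonoidHom.id _ from DFunLike.congr_fun h x
  apply FreeAbelianGroup.lift_ext
  intro t
  change barBoundaryAt (n + 1) a (FreeAbelianGroup.map _ (FreeAbelianGroup.of t)) +
      barHomotopyAt n a (barBoundaryAt n a (FreeAbelianGroup.of t)) = FreeAbelianGroup.of t
  rw [FreeAbelianGroup.map_of_apply]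
  simp only [barBoundaryAt, FreeAbelianGroup.lift_apply_of]
  rw [Fin.sum_univ_succ, face_zero_consOne, map_sum, add_assoc, ← Finset.sum_add_distrib,
    Finset.sum_eq_zero]
  · simp
  · intro i _
    rw [map_zsmul, barHomotopyAt, FreeAbelianGroup.map_of_apply, face_succ_consOne, Fin.val_succ,
      pow_succ, mul_neg_one, neg_smul, neg_add_cancel]

/-- The symbol `[1, a]`. -/
def Fac.symbol (a : Fac S) : Symbol 0 a := ⟨![1, a.val], by simp [tprod]⟩

/-- Here `∂[1, a₀, a₁] = [a₀, a₁] - [1, a₀a₁]`, and the last symbol is `[1, a]`. So `1 ↦ [1, a]`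
serves as the homotopy on the augmentation term. -/
theorem barBoundaryAt_barHomotopyAt_zero (x : FreeAbelianGroup (Symbol 0 a)) :
    barBoundaryAt 0 a (barHomotopyAt 0 a x) +
      (FreeAbelianGroup.lift (fun _ => (ULift.up 1 : ULift.{u} ℤ)) x).down •
        FreeAbelianGroup.of a.symbol = x := by
  suffices h : (barBoundaryAt 0 a).comp (barHomotopyAt 0 a) +
      (zmultiplesHom _ (FreeAbelianGroup.of a.symbol)).comp (AddEquiv.ulift.toAddMonoidHom.comp
        (FreeAbelianGroup.lift (fun _ => (ULift.up 1 : ULift.{u} ℤ)))) =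
      AddMonoidHom.id _ from DFunLike.congr_fun h x
  apply FreeAbelianGroup.lift_ext
  intro t
  change barBoundaryAt 0 a (FreeAbelianGroup.map _ (FreeAbelianGroup.of t)) +
      (FreeAbelianGroup.lift (fun _ => (ULift.up 1 : ULift.{u} ℤ)) (FreeAbelianGroup.of t)).down •
        FreeAbelianGroup.of a.symbol = FreeAbelianGroup.of t
  rw [FreeAbelianGroup.map_of_apply]
  simp only [barBoundaryAt, FreeAbelianGroup.lift_apply_of]
  have h : t.consOne.face 1 = a.symbol := by
    refine Subtype.ext (funext fun k => ?_)
    change contract (Fin.cons (α := fun _ => S) 1 t.1) 1 k = ![1, a.val] k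
    have ht : t.1 0 * t.1 1 = a.val := by
      refine Eq.trans ?_ t.2
      simp [tprod]
    fin_cases k
    · simp [contract, Fin.contractNth]
    · exact ht
  rw [Fin.sum_univ_two, face_zero_consOne, h]
  simp

end Homotopy

/-! ### The bar complex resolves the trivial natural system -/

variable (S : Type u) [MonoidWithZero S]

theorem barComplex_d (n : ℕ) : (barComplex S).d (n + 1) n = barBoundary S n :=
  ChainComplex.of_d (bar S) (barBoundary S) n

theorem barComplex_exactAt_succ (n : ℕ) : (barComplex S).ExactAt (n + 1) := by
  rw [HomologicalComplex.exactAt_iff' _ (n + 2) (n + 1) n (by simp) (by simp)]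
  refine exact_of_exact_evaluation _ fun a => ?_
  rw [ShortComplex.ab_exact_iff]
  intro x hx
  have hx' : barBoundaryAt n a x = 0 := by
    have h : ((barComplex S).d (n + 1) n).app a x = 0 := hx
    rw [barComplex_d] at h
    exact h
  refine ⟨barHomotopyAt (n + 1) a x, ?_⟩
  change ((barComplex S).d (n + 2) (n + 1)).app a _ = x
  rw [barComplex_d]
  have := barBoundaryAt_barHomotopyAt_succ x
  rwa [hx', map_zero, add_zero] at this

theorem barAugmentation_f_zero : (barAugmentation S).f 0 = barAugmentation₀ S :=
  ChainComplex.toSingle₀Equiv_symm_apply_f_zero _ _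

theorem barAugmentation₀_exact (w : barBoundary S 0 ≫ barAugmentation₀ S = 0) :
    (ShortComplex.mk _ _ w).Exact := by
  refine exact_of_exact_evaluation _ fun a => ?_
  rw [ShortComplex.ab_exact_iff]
  intro x hx
  have hx' : FreeAbelianGroup.lift (fun _ : Symbol 0 a => (ULift.up 1 : ULift.{u} ℤ)) x = 0 := hx
  refine ⟨barHomotopyAt 0 a x, ?_⟩
  have := barBoundaryAt_barHomotopyAt_zero x
  rwa [hx', ULift.zero_down, zero_smul, add_zero] at this

instance barAugmentation₀_epi : Epi (barAugmentation₀ S) := by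
  rw [NatTrans.epi_iff_epi_app]
  intro a
  rw [AddCommGrpCat.epi_iff_surjective]
  intro m
  refine ⟨(m.down • FreeAbelianGroup.of a.symbol : FreeAbelianGroup (Symbol 0 a)), ?_⟩
  change FreeAbelianGroup.lift (fun _ => (ULift.up 1 : ULift.{u} ℤ)) _ = m
  rw [map_zsmul, FreeAbelianGroup.lift_apply_of]
  ext
  simp

instance barAugmentation_quasiIso : QuasiIso (barAugmentation S) := by
  rw [quasiIso_iff]
  rintro (_ | n)
  -- In degree 0 the outgoing differentials vanish, so the claim is exactness of `B₁ ⟶ B₀ ⟶ ℤ ⟶ 0`.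
  · rw [quasiIsoAt_iff' _ 1 0 0 (by simp) (by simp), ShortComplex.quasiIso_iff_of_zeros'
      _ ((barComplex S).shape _ _ (by simp)) rfl rfl]
    constructor
    -- The maps are generalized because those of the complex equal `barBoundary` and
    -- `barAugmentation₀` only propositionally.
    · have key : ∀ (d : bar S 1 ⟶ bar S 0) (ε : bar S 0 ⟶ trivialSystem S) (w : d ≫ ε = 0),
          d = barBoundary S 0 → ε = barAugmentation₀ S → (ShortComplex.mk d ε w).Exact := by
        rintro _ _ w rfl rfl
        exact barAugmentation₀_exact S w
      exact key _ _ _ (barComplex_d S 0) (barAugmentation_f_zero S)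
    · change Epi ((barAugmentation S).f 0)
      rw [barAugmentation_f_zero]
      exact barAugmentation₀_epi S
  · rw [quasiIsoAt_iff_exactAt' _ _ (ChainComplex.exactAt_succ_single_obj _ _)]
    exact barComplex_exactAt_succ S n

end FacCohomology
end

-- Vanishing of degree-zero classes in `Ext`

universe w v

noncomputable section

open CategoryTheory.Abelian

namespace CategoryTheory.ProjectiveResolution

open CochainComplex HomComplex

variable {C : Type u} [Category.{v} C] [Abelian C] [HasExt.{w} C]
  {X Y : C} (R : ProjectiveResolution X)

/-- A coboundary would factor through the term in degree 1 of the resolution viewed as a cochain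
complex. That complex lives in degrees at most 0, so the factorization is through zero. -/
theorem extMk_zero_eq_zero_iff (f : R.complex.X 0 ⟶ Y) (m : ℕ) (hm : 0 + 1 = m)
    (hf : R.complex.d m 0 ≫ f = 0) : R.extMk f m hm hf = 0 ↔ f = 0 := by
  refine ⟨fun h => ?_, by rintro rfl; exact R.extMk_zero m hm⟩
  rw [← R.extEquivCohomologyClass.apply_eq_iff_eq, extEquivCohomologyClass_extMk,
    extEquivCohomologyClass_zero, CohomologyClass.mk_eq_zero_iff,
    Cocycle.toSingleMk_mem_coboundaries_iff _ _ _ _ _ 1 (by simp)] at h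
  obtain ⟨g, hg⟩ := h
  rw [(CochainComplex.isZero_of_isStrictlyLE R.cochainComplex 0 1).eq_of_src g 0,
    Limits.comp_zero] at hg
  rw [← cancel_epi (R.cochainComplexXIso (-(0 : ℕ)) 0 rfl).hom, Limits.comp_zero]
  exact hg.symm

end CategoryTheory.ProjectiveResolution

/-! ### Cocycles and their classes in `Ext` -/

namespace FacCohomology

variable (S : Type u) [MonoidWithZero S]

/-- The bar resolution of the trivial natural system. -/
def barResolution : ProjectiveResolution (trivialSystem S) where
  complex := barComplex S
  projective := bar_projective S
  π := barAugmentation S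
  quasiIso := barAugmentation_quasiIso S

variable {S} {D E : NatSys S} {n : ℕ}

theorem barComplex_d_comp (φ : bar S n ⟶ D) :
    (barResolution S).complex.d (n + 1) n ≫ φ = barBoundary S n ≫ φ :=
  congrArg (fun d : bar S (n + 1) ⟶ bar S n => d ≫ φ) (barComplex_d S n)

theorem barBoundary_comp_homOfCochain_eq_zero {f : Cochain D n} (hf : coboundary D n f = 0) :
    barBoundary S n ≫ homOfCochain f = 0 := by
  rw [barBoundary_comp_homOfCochain, hf, homOfCochain_zero]

/-- The class in `Ext` of a cocycle. -/
def extOfCocycle (f : Cochain D n) (hf : coboundary D n f = 0) : Ext.{u} (trivialSystem S) D n :=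
  (barResolution S).extMk (homOfCochain f) (n + 1) rfl
    ((barComplex_d_comp _).trans (barBoundary_comp_homOfCochain_eq_zero hf))

/-- Replaces the representing morphism by an equal one, with its cocycle proof carried along. -/
theorem extOfCocycle_eq (f : Cochain D n) (hf : coboundary D n f = 0)
    (φ : (barResolution S).complex.X n ⟶ D)
    (hφ : (barResolution S).complex.d (n + 1) n ≫ φ = 0) (h : φ = homOfCochain f) :
    (barResolution S).extMk φ (n + 1) rfl hφ = extOfCocycle f hf := by
  subst h
  rfl

theorem extOfCocycle_congr {f g : Cochain D n} (h : f = g) (hf : coboundary D n f = 0)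
    (hg : coboundary D n g = 0) : extOfCocycle f hf = extOfCocycle g hg := by
  subst h
  rfl

theorem coboundary_add_eq_zero {f g : Cochain D n} (hf : coboundary D n f = 0)
    (hg : coboundary D n g = 0) : coboundary D n (f + g) = 0 := by
  rw [map_add, hf, hg, add_zero]

theorem extOfCocycle_add {f g : Cochain D n} (hf : coboundary D n f = 0)
    (hg : coboundary D n g = 0) :
    extOfCocycle (f + g) (coboundary_add_eq_zero hf hg) = extOfCocycle f hf + extOfCocycle g hg :=
  (extOfCocycle_eq _ _ _ _ (homOfCochain_add f g).symm).symm.trans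
    ((barResolution S).add_extMk _ _ _ _ _ _).symm

theorem extOfCocycle_surjective (α : Ext.{u} (trivialSystem S) D n) :
    ∃ (f : Cochain D n) (hf : coboundary D n f = 0), extOfCocycle f hf = α := by
  obtain ⟨φ, hφ, rfl⟩ := (barResolution S).extMk_surjective α (n + 1) rfl
  have hφ' : barBoundary S n ≫ (show bar S n ⟶ D from φ) = 0 :=
    (barComplex_d_comp _).symm.trans hφ
  refine ⟨cochainOfHom φ, (cochainOfHom_barBoundary_comp φ).symm.trans ?_,
    (extOfCocycle_eq _ _ φ hφ (homOfCochain_cochainOfHom φ).symm).symm⟩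
  exact congrArg cochainOfHom hφ'

theorem extOfCocycle_comp (f : Cochain D n) (hf : coboundary D n f = 0) (φ : D ⟶ E) :
    (extOfCocycle f hf).comp (Ext.mk₀ φ) (add_zero n) =
      extOfCocycle (cochainMap φ n f) (by rw [coboundary_cochainMap, hf, map_zero]) :=
  ((barResolution S).extMk_comp_mk₀ _ _ _ _ φ).trans
    (extOfCocycle_eq _ _ _ _ (homOfCochain_comp f φ))

theorem extOfCocycle_zero_eq_zero_iff (f : Cochain D 0) (hf : coboundary D 0 f = 0) :
    extOfCocycle f hf = 0 ↔ f = 0 := by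
  refine ((barResolution S).extMk_zero_eq_zero_iff _ _ _ _).trans ⟨fun h => ?_, ?_⟩
  · exact (cochainOfHom_homOfCochain f).symm.trans (congrArg cochainOfHom h)
  · rintro rfl
    exact homOfCochain_zero

/-- The class vanishes exactly when the representing morphism factors through `∂`; by Yoneda the
second factor is a cochain with coboundary `f`. -/
theorem extOfCocycle_succ_eq_zero_iff (f : Cochain D (n + 1)) (hf : coboundary D (n + 1) f = 0) :
    extOfCocycle f hf = 0 ↔ ∃ g : Cochain D n, coboundary D n g = f := by
  refine ((barResolution S).extMk_eq_zero_iff _ _ _ _ n rfl).trans ⟨?_, ?_⟩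
  · rintro ⟨g, hg⟩
    exact ⟨cochainOfHom g, (cochainOfHom_barBoundary_comp g).symm.trans
      ((congrArg cochainOfHom ((barComplex_d_comp g).symm.trans hg)).trans
        (cochainOfHom_homOfCochain f))⟩
  · rintro ⟨g, rfl⟩
    exact ⟨homOfCochain g, (barComplex_d_comp _).trans (barBoundary_comp_homOfCochain g)⟩

/-! ### Descent from cocycles to cohomology -/

theorem cochainComplex_d (D : NatSys S) (n : ℕ) :
    (cochainComplex D).d n (n + 1) = AddCommGrpCat.ofHom (coboundary D n) := by
  simp only [cochainComplex, CochainComplex.of_d]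

theorem zeroCochainComplex_d (A : ZeroModule S) (n : ℕ) :
    (zeroCochainComplex A).d n (n + 1) = AddCommGrpCat.ofHom (zeroCoboundary A n) := by
  simp only [zeroCochainComplex, CochainComplex.of_d]

theorem coboundary_iCycles (z : (cochainComplex D).cycles n) :
    coboundary D n ((cochainComplex D).iCycles n z) = 0 := by
  have h := (cochainComplex D).iCycles_d n (n + 1)
  rw [cochainComplex_d] at h
  exact congrArg (fun g => g z) h

/-- The homomorphism sending a cocycle to its class in `Ext`. -/
def cyclesToExt (D : NatSys S) (n : ℕ) :
    (cochainComplex D).cycles n ⟶ (extFunctorObj.{u} (trivialSystem S) n).obj D :=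
  AddCommGrpCat.ofHom (AddMonoidHom.mk'
    (fun z => extOfCocycle ((cochainComplex D).iCycles n z) (coboundary_iCycles z))
    (fun z z' => (extOfCocycle_congr (map_add ((cochainComplex D).iCycles n).hom z z') _
      (coboundary_add_eq_zero (coboundary_iCycles z) (coboundary_iCycles z'))).trans
        (extOfCocycle_add _ _)))

theorem cyclesToExt_apply (z : (cochainComplex D).cycles n) :
    cyclesToExt D n z =
      extOfCocycle ((cochainComplex D).iCycles n z) (coboundary_iCycles z) := rfl

theorem exists_iCycles_eq (f : Cochain D n) (hf : coboundary D n f = 0) :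
    ∃ z : (cochainComplex D).cycles n, (cochainComplex D).iCycles n z = f := by
  refine (ShortComplex.ab_exact_iff _).1 (ShortComplex.exact_of_f_is_kernel
    (ShortComplex.mk _ _ ((cochainComplex D).iCycles_d n (n + 1)))
    ((cochainComplex D).cyclesIsKernel n (n + 1) (by simp))) f ?_
  change (cochainComplex D).d n (n + 1) f = 0
  rw [cochainComplex_d]
  exact hf

theorem cyclesToExt_surjective : Function.Surjective (cyclesToExt D n) := by
  intro α
  obtain ⟨f, hf, rfl⟩ := extOfCocycle_surjective α
  obtain ⟨z, rfl⟩ := exists_iCycles_eq f hf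
  exact ⟨z, rfl⟩

/-- Stated through `prev` so that it also covers degree 0, where `prev` takes the default value 0.
-/
theorem homologyπ_eq_zero_iff (K : CochainComplex AddCommGrpCat.{u} ℕ) {n m : ℕ}
    (hm : (ComplexShape.up ℕ).prev n = m) (z : K.cycles n) :
    K.homologyπ n z = 0 ↔ ∃ y : K.X m, K.d m n y = K.iCycles n z := by
  have hT := (ShortComplex.mk _ _ (K.toCycles_comp_homologyπ m n)).exact_of_g_is_cokernel
    (K.homologyIsCokernel m n hm)
  have hd (y : K.X m) : K.iCycles n (K.toCycles m n y) = K.d m n y :=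
    congrArg (fun g => g y) (K.toCycles_i m n)
  constructor
  · intro h
    obtain ⟨y, hy⟩ := (ShortComplex.ab_exact_iff _).1 hT z h
    exact ⟨y, (hd y).symm.trans (congrArg (K.iCycles n) hy)⟩
  · rintro ⟨y, hy⟩
    obtain rfl : K.toCycles m n y = z :=
      (AddCommGrpCat.mono_iff_injective (K.iCycles n)).1 inferInstance ((hd y).trans hy)
    exact congrArg (fun g => g y) (K.toCycles_comp_homologyπ m n)

/-- The projections of cocycles to `Ext` and to homology have the same kernel. One direction makes
the map descend to cohomology, the other makes the descended map injective. -/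
theorem cyclesToExt_eq_zero_iff (z : (cochainComplex D).cycles n) :
    cyclesToExt D n z = 0 ↔ (cochainComplex D).homologyπ n z = 0 := by
  rw [cyclesToExt_apply]
  cases n with
  | zero =>
    refine (extOfCocycle_zero_eq_zero_iff _ _).trans ?_
    -- The differential from degree 0 to itself is zero, so the right-hand side says that the
    -- cocycle itself is zero.
    rw [homologyπ_eq_zero_iff _ (m := 0) (by simp), (cochainComplex D).shape 0 0 (by simp)]
    exact ⟨fun h => ⟨0, h.symm⟩, fun ⟨_, h⟩ => h.symm⟩
  | succ n =>
    refine (extOfCocycle_succ_eq_zero_iff _ _).trans ?_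
    rw [homologyπ_eq_zero_iff _ (m := n) (by simp), cochainComplex_d]
    rfl

/-- The homomorphism from cohomology to `Ext`. -/
def cohomologyToExtApp (D : NatSys S) (n : ℕ) :
    (cohomology S n).obj D ⟶ (extFunctorObj.{u} (trivialSystem S) n).obj D :=
  ((cochainComplex D).homologyIsCokernel _ n rfl).desc
    (Limits.CokernelCofork.ofπ (cyclesToExt D n) (by
      ext y
      refine (cyclesToExt_eq_zero_iff _).2 ?_
      exact congrArg (fun g => g y) ((cochainComplex D).toCycles_comp_homologyπ _ n)))

theorem homologyπ_comp_cohomologyToExtApp (D : NatSys S) (n : ℕ) :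
    (cochainComplex D).homologyπ n ≫ cohomologyToExtApp D n = cyclesToExt D n :=
  ((cochainComplex D).homologyIsCokernel _ n rfl).fac _ Limits.WalkingParallelPair.one

theorem homologyπ_surjective (K : CochainComplex AddCommGrpCat.{u} ℕ) (n : ℕ) :
    Function.Surjective (K.homologyπ n) :=
  (AddCommGrpCat.epi_iff_surjective _).1 inferInstance

theorem cohomologyToExtApp_homologyπ (z : (cochainComplex D).cycles n) :
    cohomologyToExtApp D n ((cochainComplex D).homologyπ n z) = cyclesToExt D n z :=
  congrArg (fun g => g z) (homologyπ_comp_cohomologyToExtApp D n)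

theorem cohomologyToExtApp_bijective (D : NatSys S) (n : ℕ) :
    Function.Bijective (cohomologyToExtApp D n) := by
  constructor
  · refine (injective_iff_map_eq_zero (cohomologyToExtApp D n).hom).2 fun x hx => ?_
    obtain ⟨z, rfl⟩ := homologyπ_surjective _ n x
    exact (cyclesToExt_eq_zero_iff z).1 ((cohomologyToExtApp_homologyπ z).symm.trans hx)
  · intro α
    obtain ⟨z, rfl⟩ := cyclesToExt_surjective α
    exact ⟨_, cohomologyToExtApp_homologyπ z⟩

theorem cyclesToExt_naturality (φ : D ⟶ E) (n : ℕ) :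
    HomologicalComplex.cyclesMap ((cochainFunctor S).map φ) n ≫ cyclesToExt E n =
      cyclesToExt D n ≫ (extFunctorObj.{u} (trivialSystem S) n).map φ := by
  ext z
  have h : (cochainComplex E).iCycles n
      (HomologicalComplex.cyclesMap ((cochainFunctor S).map φ) n z) =
      cochainMap φ n ((cochainComplex D).iCycles n z) :=
    congrArg (fun g => g z) (HomologicalComplex.cyclesMap_i ((cochainFunctor S).map φ) n)
  exact (extOfCocycle_congr h (coboundary_iCycles _) _).trans
    (extOfCocycle_comp _ (coboundary_iCycles z) φ).symm

/-- The isomorphism from cohomology to `Ext`, natural in the natural system. -/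
def cohomologyIsoExt (S : Type u) [MonoidWithZero S] (n : ℕ) :
    cohomology S n ≅ extFunctorObj.{u} (trivialSystem S) n :=
  have (D : NatSys S) : IsIso (cohomologyToExtApp D n) :=
    (ConcreteCategory.isIso_iff_bijective _).2 (cohomologyToExtApp_bijective D n)
  NatIso.ofComponents (fun D => asIso (cohomologyToExtApp D n)) fun {D E} φ => by
    -- The projection from cocycles is an epimorphism, so naturality reduces to
    -- `cyclesToExt_naturality`.
    refine (cancel_epi ((cochainComplex D).homologyπ n)).1 ?_
    have h₁ := HomologicalComplex.homologyπ_naturality ((cochainFunctor S).map φ) n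
    have h₂ := homologyπ_comp_cohomologyToExtApp D n
    have h₃ := homologyπ_comp_cohomologyToExtApp E n
    have h₄ := cyclesToExt_naturality φ n
    exact ((Category.assoc _ _ _).symm.trans (congrArg (· ≫ cohomologyToExtApp E n) h₁)).trans
      ((Category.assoc _ _ _).trans ((congrArg (_ ≫ ·) h₃).trans (h₄.trans
        ((congrArg (· ≫ _) h₂.symm).trans (Category.assoc _ _ _)))))

/-! ### 0-cohomology as a restriction of the cohomology of natural systems -/

/-- The complex of 0-cochains of a 0-module is the cochain complex of its natural system. -/
def zeroCochainFunctorIso (S : Type u) [MonoidWithZero S] :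
    zeroCochainFunctor S ≅ zeroModuleToNatSys S ⋙ cochainFunctor S :=
  NatIso.ofComponents
    -- The cochain groups coincide definitionally; only the agreement of the differentials,
    -- `zeroCoboundary_eq`, needs proof.
    (fun A => HomologicalComplex.Hom.isoOfComponents (fun _ => Iso.refl _) (by
      rintro n _ rfl
      change 𝟙 _ ≫ (cochainComplex A.toNatSys).d n (n + 1) =
        (zeroCochainComplex A).d n (n + 1) ≫ 𝟙 _
      rw [cochainComplex_d, zeroCochainComplex_d]
      ext1
      ext1 f
      exact (zeroCoboundary_eq A n f).symm))
    (fun φ => rfl)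

/-- The isomorphism from 0-cohomology to `Ext`, natural in the 0-module. -/
def zeroCohomologyIsoExt (S : Type u) [MonoidWithZero S] (n : ℕ) :
    zeroCohomology S n ≅ zeroModuleToNatSys S ⋙ extFunctorObj.{u} (trivialSystem S) n :=
  Functor.isoWhiskerRight (zeroCochainFunctorIso S) (HomologicalComplex.homologyFunctor _ _ n) ≪≫
    Functor.isoWhiskerLeft (zeroModuleToNatSys S) (cohomologyIsoExt S n)

end FacCohomology

end

theorem theorem14 (S : Type u) [MonoidWithZero S] :
    (∀ n : ℕ, Nonempty (FacCohomology.cohomology S n ≅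
      Abelian.extFunctorObj.{u} (FacCohomology.trivialSystem S) n)) ∧
    ((∀ n : ℕ, Projective (FacCohomology.bar S n)) ∧
      QuasiIso (FacCohomology.barAugmentation S)) ∧
    (∀ n : ℕ, Nonempty (FacCohomology.zeroCohomology S n ≅
      FacCohomology.zeroModuleToNatSys S ⋙
        Abelian.extFunctorObj.{u} (FacCohomology.trivialSystem S) n)) :=
  ⟨fun n => ⟨FacCohomology.cohomologyIsoExt S n⟩,
    ⟨FacCohomology.bar_projective S, FacCohomology.barAugmentation_quasiIso S⟩,
    fun n => ⟨FacCohomology.zeroCohomologyIsoExt S n⟩⟩
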